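/- Let $(\mathbf A,\mathbf b,\mathbf c)$ be the Butcher tableau of an $s$-stage Runge--Kutta (RK) method of order $\hat p\ge 1$, put $\hat p^*=\max\{\hat p-1,1\}$, and let $\bar b_1,\dots,\bar b_s$ be real-valued weight functions on $[0,1]$. Let $\Theta\subseteq[0,1]$ be a set on which all $\bar b_j$ are bounded (for instance a single point $\Theta=\{\theta\}$), and assume that $\bar b_1,\dots,\bar b_s$, together with the stages of the RK method, form a dense output formula of order $\hat p^*$ on $\Theta$: for every autonomous problem $\mathbf y'=\mathbf g(\mathbf y)$, $\mathbf y(0)=\mathbf y_0$, with $\mathbf g$ of class $C^{\hat p^*+1}$ near $\mathbf y_0$, $$\mathbf y_0+\Delta t\sum_{j=1}^s\bar b_j(\theta)\,\mathbf g(\mathbf y^{(j)})=\mathbf y(\theta\Delta t)+O(\Delta t^{\hat p^*+1}),$$ where $\mathbf y^{(i)}=\mathbf y_0+\Delta t\sum_j a_{ij}\mathbf g(\mathbf y^{(j)})$ are the RK stages (those tending to $\mathbf y_0$, if the method is implicit). Order $\hat p$ of the RK method means likewise that its local error is $O(\Delta t^{\hat p+1})$ for every autonomous problem with right-hand side of class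 $C^{\hat p+1}$ near the initial value. Let $D\subseteq\mathbb R^d$ be open, let $\mathbf f^{[1]},\dots,\mathbf f^{[N]}\in C^{\hat p^*+1}(D,\mathbb R^d)$, and let $\mathbf y^n\in D$. Consider, for small $\Delta t>0$, the nonstandard additive RK method $$\mathbf y^{(i)}=\mathbf y^n+\Delta t\sum_{j=1}^s\sum_{\nu=1}^N a_{ij}^{[\nu]}(\mathbf y^n,\Delta t)\,\mathbf f^{[\nu]}(\mathbf y^{(j)}),\quad i=1,\dots,s,$$ $$\mathbf y^{n+\theta}=\mathbf y^n+\Delta t\sum_{j=1}^s\sum_{\nu=1}^N b_j^{[\nu]}(\mathbf y^n,\Delta t,\theta)\,\mathbf f^{[\nu]}(\mathbf y^{(j)}),$$ where either the method is explicit (for all small $\Delta t$, $a_{ij}^{[\nu]}(\mathbf y^n,\Delta t)=0$ for $j\ge i$ and all $\nu$), or the stages $\mathbf y^{(i)}$ stay in a compact subset of $D$ as $\Delta t\to0$. Suppose that $$a_{ij}^{[\nu]}(\mathbf y^n,\Delta t)=a_{ij}+O(\Delta t^{\hat p^*-1}),\qquad b_j^{[\nu]}(\mathbf y^n,\Delta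 t,\theta)=\bar b_j(\theta)+O(\Delta t^{\hat p^*})$$ for $i,j=1,\dots,s$ and $\nu=1,\dots,N$. Then $$\mathbf y^{n+\theta}=\mathrm{NB}^\theta_{\hat p^*}(\tfrac1\gamma,\mathbf y^n)+O(\Delta t^{\hat p^*+1}).$$ All $O$-terms are for $\Delta t\to0^+$ with $\mathbf y^n$ (respectively $\mathbf y_0$) fixed, and those involving $\theta$ are uniform in $\theta\in\Theta$. Here $$\mathrm{NB}^\theta_{p}(u,\mathbf y)=\mathbf y+\sum_{\tau\in NT_p}\frac{(\theta\Delta t)^{|\tau|}}{\sigma(\tau)}\,u(\tau)\,\mathcal F(\tau)(\mathbf y),$$ where $NT_p$ is the set of rooted trees with at least one and at most $p$ nodes, each node coloured by an element of $\{1,\dots,N\}$, up to isomorphism; $|\tau|$ is the number of nodes, and for $\tau=[\tau_1,\dots,\tau_l]^{[\nu]}$ (root colour $\nu$, children $\tau_1,\dots,\tau_l$) the density is $\gamma(\tau)=|\tau|\prod_i\gamma(\tau_i)$, the symmetry is $\sigma(\tau)=\prod_i\sigma(\tau_i)\cdot\prod_k m_k!$ with $m_k$ the multiplicities of the distinct children,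 and the elementary differential is $\mathcal F(\tau)(\mathbf y)=D^l\mathbf f^{[\nu]}(\mathbf y)[\mathcal F(\tau_1)(\mathbf y),\dots,\mathcal F(\tau_l)(\mathbf y)]$. -/

import Mathlib

open Filter Topology Asymptotics
open scoped Nat

noncomputable section

/-! ### Coloured rooted trees (`N`-trees) -/

/-- Rooted trees whose nodes carry a colour in `Fin N` and whose children are listed in some order. -/
inductive OTree (N : ℕ) : Type
  | node : Fin N → List (OTree N) → OTree N

namespace OTree

variable {N : ℕ}

/-- Equality of trees up to reordering of children, at every node: the least equivalence relation
that allows permuting the children of the root and replacing a child by an equivalent one. -/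
inductive Iso : OTree N → OTree N → Prop
  | refl (t : OTree N) : Iso t t
  | symm {t t' : OTree N} : Iso t t' → Iso t' t
  | trans {t t' t'' : OTree N} : Iso t t' → Iso t' t'' → Iso t t''
  | perm (c : Fin N) {l l' : List (OTree N)} : l.Perm l' → Iso (node c l) (node c l')
  | child (c : Fin N) {t t' : OTree N} (l : List (OTree N)) :
      Iso t t' → Iso (node c (t :: l)) (node c (t' :: l))

instance isoSetoid (N : ℕ) : Setoid (OTree N) where
  r := Iso
  iseqv := ⟨Iso.refl, Iso.symm, Iso.trans⟩

mutual
/-- Number of nodes. -/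
def order : OTree N → ℕ
  | node _ l => 1 + orderSum l
/-- Sum of the numbers of nodes of the trees in a list. -/
def orderSum : List (OTree N) → ℕ
  | [] => 0
  | t :: l => order t + orderSum l
end

mutual
/-- Density: `γ([τ₁, …, τₗ]) = |τ| γ(τ₁) ⋯ γ(τₗ)`. -/
def density : OTree N → ℕ
  | node _ l => (1 + orderSum l) * densityProd l
/-- Product of the densities of the trees in a list. -/
def densityProd : List (OTree N) → ℕ
  | [] => 1
  | t :: l => density t * densityProd l
end

/-- The multiset of the isomorphism classes of the trees in a list. -/
def classes (l : List (OTree N)) : Multiset (Quotient (isoSetoid N)) :=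
  (l : Multiset (OTree N)).map (Quotient.mk _)

open Classical in
/-- `m₁! m₂! ⋯`, where `m₁, m₂, …` are the multiplicities of the distinct members of `m`. -/
def multFactorial {α : Type*} (m : Multiset α) : ℕ :=
  ∏ a ∈ m.toFinset, (m.count a)!

mutual
/-- Symmetry: if `τ` has the distinct children `τ₁, τ₂, …` with multiplicities `m₁, m₂, …`, then
`σ(τ) = ∏ mᵢ! σ(τᵢ) ^ mᵢ`. -/
def symmetry : OTree N → ℕ
  | node _ l => multFactorial (classes l) * symmetryProd l
/-- Product of the symmetries of the trees in a list. -/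
def symmetryProd : List (OTree N) → ℕ
  | [] => 1
  | t :: l => symmetry t * symmetryProd l
end

mutual
/-- Elementary differential: `F([τ₁, …, τₗ]^[ν])(y) = D^l f^[ν](y) [F(τ₁)(y), …, F(τₗ)(y)]`. -/
def elemDiff {E : Type*} [NormedAddCommGroup E] [NormedSpace ℝ E]
    (f : Fin N → E → E) (y : E) : OTree N → E
  | node c l =>
      iteratedFDeriv ℝ (elemDiffs f y l).length (f c) y (fun i => (elemDiffs f y l).get i)
/-- The elementary differentials of the trees in a list. -/
def elemDiffs {E : Type*} [NormedAddCommGroup E] [NormedSpace ℝ E]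
    (f : Fin N → E → E) (y : E) : List (OTree N) → List E
  | [] => []
  | t :: l => elemDiff f y t :: elemDiffs f y l
end

theorem orderSum_eq (l : List (OTree N)) : orderSum l = (l.map order).sum := by
  induction l with
  | nil => simp [orderSum]
  | cons t l ih => simp [orderSum, ih]

theorem densityProd_eq (l : List (OTree N)) : densityProd l = (l.map density).prod := by
  induction l with
  | nil => simp [densityProd]
  | cons t l ih => simp [densityProd, ih]

theorem symmetryProd_eq (l : List (OTree N)) : symmetryProd l = (l.map symmetry).prod := by
  induction l with
  | nil => simp [symmetryProd]
  | cons t l ih => simp [symmetryProd, ih]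

theorem order_congr {t t' : OTree N} (h : Iso t t') : order t = order t' := by
  induction h with
  | refl => rfl
  | symm _ ih => exact ih.symm
  | trans _ _ ih1 ih2 => exact ih1.trans ih2
  | perm c hl => simp only [order, orderSum_eq]; rw [(hl.map order).sum_eq]
  | child c l _ ih => simp only [order, orderSum, ih]

theorem density_congr {t t' : OTree N} (h : Iso t t') : density t = density t' := by
  induction h with
  | refl => rfl
  | symm _ ih => exact ih.symm
  | trans _ _ ih1 ih2 => exact ih1.trans ih2
  | perm c hl =>
      simp only [density, orderSum_eq, densityProd_eq]
      rw [(hl.map order).sum_eq, (hl.map density).prod_eq]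
  | child c l h ih => simp only [density, densityProd, orderSum, ih, order_congr h]

theorem symmetry_congr {t t' : OTree N} (h : Iso t t') : symmetry t = symmetry t' := by
  induction h with
  | refl => rfl
  | symm _ ih => exact ih.symm
  | trans _ _ ih1 ih2 => exact ih1.trans ih2
  | perm c hl =>
      simp only [symmetry, symmetryProd_eq, classes]
      rw [(hl.map symmetry).prod_eq, Multiset.coe_eq_coe.2 hl]
  | @child c t t' l h ih =>
      have : classes (t :: l) = classes (t' :: l) := by
        have hq : (Quotient.mk (isoSetoid N) t) = Quotient.mk _ t' := Quotient.sound h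
        simp only [classes, ← Multiset.cons_coe, Multiset.map_cons, hq]
      simp only [symmetry, symmetryProd, ih, this]

theorem order_le_orderSum {t : OTree N} {l : List (OTree N)} (h : t ∈ l) :
    order t ≤ orderSum l := by
  rw [orderSum_eq]; exact List.single_le_sum (by simp) _ (List.mem_map_of_mem h)

theorem one_le_order (t : OTree N) : 1 ≤ order t := by
  cases t; simp [order]

theorem length_le_orderSum (l : List (OTree N)) : l.length ≤ orderSum l := by
  induction l with
  | nil => simp
  | cons t l ih => have := one_le_order t; simp only [orderSum, List.length_cons]; omega

theorem finite_order_le (N n : ℕ) : {t : OTree N | order t ≤ n}.Finite := by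
  induction n with
  | zero =>
      refine Set.finite_empty.subset fun t ht => ?_
      have := one_le_order t
      simp only [Set.mem_ofPred_eq] at ht
      omega
  | succ n ih =>
      have := ih.to_subtype
      have hl := List.finite_length_le {t : OTree N | order t ≤ n} n
      refine ((Set.finite_univ (α := Fin N)).prod (hl.image (List.map Subtype.val))
        |>.image fun x => node x.1 x.2).subset ?_
      rintro ⟨c, l⟩ ht
      simp only [Set.mem_ofPred_eq, order] at ht
      have hm : ∀ t ∈ l, order t ≤ n := fun t h => by
        have := order_le_orderSum h
        omega
      have hlen := length_le_orderSum l
      refine ⟨(c, l), ⟨Set.mem_univ _, l.attach.map fun t => ⟨t.1, hm t.1 t.2⟩, ?_, ?_⟩, rfl⟩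
      · change List.length _ ≤ n
        simp only [List.length_map, List.length_attach]; omega
      · simp

end OTree

/-- `N`-trees: rooted trees with nodes coloured by `Fin N`, up to isomorphism. -/
def NTree (N : ℕ) : Type := Quotient (OTree.isoSetoid N)

namespace NTree

variable {N : ℕ}

/-- `|τ|`, the number of nodes. -/
def order (τ : NTree N) : ℕ := Quotient.lift OTree.order (fun _ _ h => OTree.order_congr h) τ

/-- The density `γ(τ)`. -/
def density (τ : NTree N) : ℕ :=
  Quotient.lift OTree.density (fun _ _ h => OTree.density_congr h) τ

/-- The symmetry `σ(τ)`. -/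
def symmetry (τ : NTree N) : ℕ :=
  Quotient.lift OTree.symmetry (fun _ _ h => OTree.symmetry_congr h) τ

/-- The elementary differential `F(τ)(y)`, computed with some ordering of the children. For
functions `f ν` that are `|τ| - 1` times continuously differentiable near `y` the value does not
depend on that ordering, as higher derivatives are then symmetric. -/
def elemDiff {E : Type*} [NormedAddCommGroup E] [NormedSpace ℝ E]
    (f : Fin N → E → E) (τ : NTree N) (y : E) : E :=
  OTree.elemDiff f y (Quotient.out τ)

theorem finite_order_le (N p : ℕ) : {τ : NTree N | τ.order ≤ p}.Finite := by
  refine ((OTree.finite_order_le N p).image (Quotient.mk (OTree.isoSetoid N))).subset ?_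
  intro τ hτ
  induction τ using Quotient.ind with
  | _ t => exact ⟨t, hτ, rfl⟩

/-- `NT_p`, the finite set of all `N`-trees with at most `p` nodes. -/
def upTo (N p : ℕ) : Finset (NTree N) := (finite_order_le N p).toFinset

end NTree

/-- The truncated series
`NB^θ_p(u, y) = y + ∑_{τ ∈ NT_p} (θ Δt)^|τ| / σ(τ) * u(τ) F(τ)(y)` with step size `Δt = h`. -/
def NBseries {N : ℕ} {E : Type*} [NormedAddCommGroup E] [NormedSpace ℝ E]
    (f : Fin N → E → E) (p : ℕ) (u : NTree N → ℝ) (y : E) (h θ : ℝ) : E :=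
  y + ∑ τ ∈ NTree.upTo N p, ((θ * h) ^ τ.order / (τ.symmetry : ℝ) * u τ) • τ.elemDiff f y

/-! ### Runge–Kutta methods and dense output -/

/-- A Butcher tableau with `s` stages. The nodes `c` do not enter for autonomous equations. -/
structure Tableau (s : ℕ) where
  A : Fin s → Fin s → ℝ
  b : Fin s → ℝ
  c : Fin s → ℝ

/-- `Y 1, …, Y s` are Runge–Kutta stages for `y' = g(y)` from `y₀` with step size `h`. -/
def IsRKStages {s : ℕ} {E : Type*} [AddCommGroup E] [Module ℝ E]
    (A : Fin s → Fin s → ℝ) (g : E → E) (y₀ : E) (h : ℝ) (Y : Fin s → E) : Prop :=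
  ∀ i, Y i = y₀ + h • ∑ j, A i j • g (Y j)

/-- The Runge–Kutta output with weights `w` and stages `Y`. -/
def rkOutput {s : ℕ} {E : Type*} [AddCommGroup E] [Module ℝ E]
    (w : Fin s → ℝ) (g : E → E) (y₀ : E) (h : ℝ) (Y : Fin s → E) : E :=
  y₀ + h • ∑ j, w j • g (Y j)

/-- `y` solves `y' = g(y)`, `y(0) = y₀`, near time `0`. -/
def IsLocalSolution {E : Type*} [NormedAddCommGroup E] [NormedSpace ℝ E]
    (g : E → E) (y₀ : E) (y : ℝ → E) : Prop :=
  y 0 = y₀ ∧ ∀ᶠ t in 𝓝 (0 : ℝ), HasDerivAt y (g (y t)) t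

/-- The Runge–Kutta method has order `p`: the local error is `O(h ^ (p + 1))` for every autonomous
problem with right-hand side of class `C^(p+1)` near the initial value. (For implicit methods, the
stages are those that tend to the initial value.) -/
def Tableau.HasOrder {s : ℕ} (M : Tableau s) (p : ℕ) : Prop :=
  ∀ (d : ℕ) (U : Set (EuclideanSpace ℝ (Fin d)))
    (g : EuclideanSpace ℝ (Fin d) → EuclideanSpace ℝ (Fin d)) (y₀ : EuclideanSpace ℝ (Fin d))
    (y : ℝ → EuclideanSpace ℝ (Fin d)) (Y : ℝ → Fin s → EuclideanSpace ℝ (Fin d)),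
    IsOpen U → ContDiffOn ℝ ((p + 1 : ℕ) : WithTop ℕ∞) g U → y₀ ∈ U → IsLocalSolution g y₀ y →
    (∀ᶠ h in 𝓝[>] (0 : ℝ), IsRKStages M.A g y₀ h (Y h)) →
    (∀ i, Tendsto (fun h => Y h i) (𝓝[>] (0 : ℝ)) (𝓝 y₀)) →
    (fun h : ℝ => rkOutput M.b g y₀ h (Y h) - y h) =O[𝓝[>] (0 : ℝ)] fun h => h ^ (p + 1)

/-- The formula with stages given by `M` and weights `bbar j θ`, `θ ∈ Θ`, is a dense output formula
of order `q` on `Θ`: its difference to `y(θ h)` is `O(h ^ (q + 1))`, uniformly in `θ ∈ Θ`, for every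
autonomous problem with right-hand side of class `C^(q+1)` near the initial value. For a single
point `Θ = {θ}` this is the order at the relative time `θ`. -/
def Tableau.HasDenseOrderOn {s : ℕ} (M : Tableau s) (bbar : Fin s → ℝ → ℝ) (Θ : Set ℝ) (q : ℕ) :
    Prop :=
  ∀ (d : ℕ) (U : Set (EuclideanSpace ℝ (Fin d)))
    (g : EuclideanSpace ℝ (Fin d) → EuclideanSpace ℝ (Fin d)) (y₀ : EuclideanSpace ℝ (Fin d))
    (y : ℝ → EuclideanSpace ℝ (Fin d)) (Y : ℝ → Fin s → EuclideanSpace ℝ (Fin d)),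
    IsOpen U → ContDiffOn ℝ ((q + 1 : ℕ) : WithTop ℕ∞) g U → y₀ ∈ U → IsLocalSolution g y₀ y →
    (∀ᶠ h in 𝓝[>] (0 : ℝ), IsRKStages M.A g y₀ h (Y h)) →
    (∀ i, Tendsto (fun h => Y h i) (𝓝[>] (0 : ℝ)) (𝓝 y₀)) →
    (fun x : ℝ × ℝ => rkOutput (fun j => bbar j x.2) g y₀ x.1 (Y x.1) - y (x.2 * x.1))
      =O[𝓝[>] (0 : ℝ) ×ˢ 𝓟 Θ] fun x => x.1 ^ (q + 1)

/-! ### Nonstandard additive Runge–Kutta methods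

The coefficients may depend on the colour `ν`, on the current value and on the step size. -/

/-- `Y 1, …, Y s` satisfy `Y i = y₀ + h ∑_j ∑_ν a ν i j * f ν (Y j)`. -/
def IsARKStages {N s : ℕ} {E : Type*} [AddCommGroup E] [Module ℝ E]
    (a : Fin N → Fin s → Fin s → ℝ) (f : Fin N → E → E) (y₀ : E) (h : ℝ) (Y : Fin s → E) : Prop :=
  ∀ i, Y i = y₀ + h • ∑ j, ∑ ν, a ν i j • f ν (Y j)

/-- The output `y₀ + h ∑_j ∑_ν w ν j * f ν (Y j)`. -/
def arkOutput {N s : ℕ} {E : Type*} [AddCommGroup E] [Module ℝ E]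
    (w : Fin N → Fin s → ℝ) (f : Fin N → E → E) (y₀ : E) (h : ℝ) (Y : Fin s → E) : E :=
  y₀ + h • ∑ j, ∑ ν, w ν j • f ν (Y j)

end

-- Let g be the sum of the fields f^[ν]. The method is a perturbation of the underlying RK method
-- applied to y' = g(y). Coefficient errors O(Δt^(q-1)) in the stage equations are multiplied by Δt
-- and leave a defect O(Δt^q); these equations are contractive for small Δt, so the stages are
-- O(Δt^q)-close to genuine RK stages (`exists_isRKStages`). The output formula carries its own
-- factor Δt, so errors O(Δt^q) in weights and stages change it by O(Δt^(q+1)). The dense output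
-- order then leads to the exact value y(θΔt).
--
-- What remains is the tree series of the exact solution (`IsLocalSolution.sub_NBseries_isBigO`).
-- Let z be the truncated series with coefficients 1/(σγ). Taylor expansion of each f^[ν](z(t)) and
-- multilinearity give a sum over ordered tuples of trees; a tuple lists the children of a tree with
-- root colour ν. Counting orderings turns 1/l! into the multiplicity part of 1/σ, and the factor
-- |τ| in γ is the one produced by differentiating t^|τ|. Hence z solves the equation up to O(t^q)
-- (`NTree.isBigO_expansion`), and a defect O(t^q) means an error O(t^(q+1)).

noncomputable section

/-! ### Symmetry of higher derivatives -/

section Symmetry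

variable {E F : Type*} [NormedAddCommGroup E] [NormedSpace ℝ E]
  [NormedAddCommGroup F] [NormedSpace ℝ F]

/-- The higher derivative of `f` at `x` in the directions listed in `l`. -/
def dirDeriv (f : E → F) (l : List E) (x : E) : F :=
  iteratedFDeriv ℝ l.length f x l.get

theorem ContDiffAt.dirDeriv {f : E → F} {x : E} {n : ℕ} (l : List E)
    (hf : ContDiffAt ℝ ((l.length + n : ℕ) : WithTop ℕ∞) f x) :
    ContDiffAt ℝ n (dirDeriv f l) x := by
  have h := ContDiffAt.iteratedFDeriv_right (m := n) (i := l.length) hf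
    (by push_cast; rw [add_comm])
  exact (ContinuousMultilinearMap.apply ℝ (fun _ : Fin l.length => E) F l.get).contDiff.contDiffAt.comp
    x h

theorem dirDeriv_cons {f : E → F} {x v : E} {l : List E}
    (hf : ContDiffAt ℝ ((l.length + 1 : ℕ) : WithTop ℕ∞) f x) :
    dirDeriv f (v :: l) x = fderiv ℝ (dirDeriv f l) x v := by
  have h : DifferentiableAt ℝ (iteratedFDeriv ℝ l.length f) x :=
    (ContDiffAt.iteratedFDeriv_right (m := 1) (i := l.length) hf
      (by push_cast; rw [add_comm])).differentiableAt (by simp)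
  have h' : HasFDerivAt (dirDeriv f l)
      ((ContinuousMultilinearMap.apply ℝ (fun _ : Fin l.length => E) F l.get).comp
        (fderiv ℝ (iteratedFDeriv ℝ l.length f) x)) x :=
    (ContinuousMultilinearMap.apply ℝ (fun _ : Fin l.length => E) F
      l.get).hasFDerivAt.comp x h.hasFDerivAt
  rw [h'.fderiv]
  simp only [dirDeriv, List.length_cons]
  rw [iteratedFDeriv_succ_apply_left]
  rfl

/-- Adjacent transpositions generate all permutations, and swapping the two outermost directions is
symmetry of the second derivative of `dirDeriv f l`. The point `x` is generalized because prepending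
a direction differentiates an equality that must hold in a whole neighbourhood. -/
theorem dirDeriv_perm {f : E → F} {l l' : List E} (h : l.Perm l') {x : E}
    (hf : ContDiffAt ℝ (l.length : WithTop ℕ∞) f x) :
    dirDeriv f l x = dirDeriv f l' x := by
  induction h generalizing x with
  | nil => rfl
  | @cons v l l' hp ih =>
      rw [dirDeriv_cons (by simpa using hf), dirDeriv_cons (by simpa [hp.length_eq] using hf)]
      have hev : dirDeriv f l =ᶠ[𝓝 x] dirDeriv f l' := by
        filter_upwards [hf.eventually (by simp)] with z hz
        exact ih (hz.of_le (by simp))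
      rw [hev.fderiv_eq]
  | swap v w l =>
      have key : ∀ v w : E, dirDeriv f (v :: w :: l) x
          = fderiv ℝ (fderiv ℝ (dirDeriv f l)) x v w := by
        intro v w
        rw [dirDeriv_cons (by simpa using hf)]
        have hev : dirDeriv f (w :: l) =ᶠ[𝓝 x] fun z => fderiv ℝ (dirDeriv f l) z w := by
          filter_upwards [hf.eventually (by simp)] with z hz
          refine dirDeriv_cons (hz.of_le ?_)
          simp only [List.length_cons]; exact_mod_cast Nat.le_succ _
        rw [hev.fderiv_eq]
        have hd : ContDiffAt ℝ (2 : ℕ) (dirDeriv f l) x :=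
          ContDiffAt.dirDeriv l (by simpa [add_assoc] using hf)
        have hd' : DifferentiableAt ℝ (fderiv ℝ (dirDeriv f l)) x :=
          (hd.fderiv_right (m := 1) (by norm_num)).differentiableAt (by simp)
        rw [fderiv_clm_apply hd' (differentiableAt_const w)]
        simp
      rw [key, key]
      have hd : ContDiffAt ℝ (2 : ℕ) (dirDeriv f l) x :=
        ContDiffAt.dirDeriv l (by simpa [add_assoc] using hf)
      exact (hd.isSymmSndFDerivAt (by simp)) _ _
  | trans h1 _ ih1 ih2 => exact (ih1 hf).trans (ih2 (by rwa [← h1.length_eq]))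

end Symmetry

/-! ### The structure of `N`-trees -/

/-- The isomorphism class of a tree. -/
def NTree.mk {N : ℕ} (t : OTree N) : NTree N := Quotient.mk (OTree.isoSetoid N) t

/-- A tree in the isomorphism class `τ`. -/
def NTree.out {N : ℕ} (τ : NTree N) : OTree N := Quotient.out τ

@[simp] theorem NTree.mk_out {N : ℕ} (τ : NTree N) : NTree.mk τ.out = τ := Quotient.out_eq τ

theorem NTree.mk_eq_mk {N : ℕ} {t t' : OTree N} : NTree.mk t = NTree.mk t' ↔ OTree.Iso t t' :=
  Quotient.eq (r := OTree.isoSetoid N)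

namespace OTree

variable {N : ℕ} {E : Type*} [NormedAddCommGroup E] [NormedSpace ℝ E]

theorem elemDiffs_eq (f : Fin N → E → E) (y : E) (l : List (OTree N)) :
    elemDiffs f y l = l.map (elemDiff f y) := by
  induction l with
  | nil => simp [elemDiffs]
  | cons t l ih => simp [elemDiffs, ih]

theorem elemDiff_node (f : Fin N → E → E) (y : E) (c : Fin N) (l : List (OTree N)) :
    elemDiff f y (node c l) = dirDeriv (f c) (l.map (elemDiff f y)) y := by
  rw [elemDiff, elemDiffs_eq]; rfl

/-- Makes the choice of representative in `NTree.elemDiff` harmless. A node with l children spans at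
least l + 1 nodes, so C^n suffices up to order n + 1. -/
theorem elemDiff_congr {f : Fin N → E → E} {y : E} {n : ℕ} (hf : ∀ c, ContDiffAt ℝ n (f c) y)
    {t t' : OTree N} (h : Iso t t') (ht : order t ≤ n + 1) : elemDiff f y t = elemDiff f y t' := by
  induction h with
  | refl => rfl
  | symm h ih => exact (ih (by rwa [order_congr h])).symm
  | trans h1 _ ih1 ih2 => exact (ih1 ht).trans (ih2 (by rwa [← order_congr h1]))
  | @perm c l l' hl =>
      rw [elemDiff_node, elemDiff_node]
      refine dirDeriv_perm (hl.map _) ((hf c).of_le ?_)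
      have := length_le_orderSum l
      simp only [order] at ht
      rw [List.length_map]
      exact_mod_cast (by omega : l.length ≤ n)
  | child c l h ih =>
      rw [elemDiff_node, elemDiff_node, List.map_cons, List.map_cons, ih]
      simp only [order, orderSum] at ht
      omega

/-- `Iso.child` replaces only the first child, so each replaced child is moved behind the remaining
ones; `m` collects those already treated. -/
theorem iso_node_of_forall₂ (c : Fin N) {l l' : List (OTree N)} (h : List.Forall₂ Iso l l')
    (m : List (OTree N)) : Iso (node c (l ++ m)) (node c (l' ++ m)) := by
  induction h generalizing m with
  | nil => exact .refl _
  | @cons a b l l' hab _ ih =>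
      refine (Iso.child c (l ++ m) hab).trans ?_
      refine (Iso.perm c (l' := l ++ (b :: m)) ?_).trans ((ih (b :: m)).trans (Iso.perm c ?_))
      · exact List.perm_middle.symm
      · exact List.perm_middle

/-- The colour of the root. -/
def root : OTree N → Fin N
  | node c _ => c

/-- The isomorphism classes of the children of the root. -/
def children : OTree N → Multiset (NTree N)
  | node _ l => ((l.map NTree.mk : List (NTree N)) : Multiset (NTree N))

theorem root_congr {t t' : OTree N} (h : Iso t t') : root t = root t' := by
  induction h with
  | refl => rfl
  | symm _ ih => exact ih.symm
  | trans _ _ ih1 ih2 => exact ih1.trans ih2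
  | perm c hl => rfl
  | child c l _ ih => rfl

theorem children_congr {t t' : OTree N} (h : Iso t t') : children t = children t' := by
  induction h with
  | refl => rfl
  | symm _ ih => exact ih.symm
  | trans _ _ ih1 ih2 => exact ih1.trans ih2
  | perm c hl => exact Multiset.coe_eq_coe.2 (hl.map _)
  | child c l h _ => simp only [children, List.map_cons, NTree.mk_eq_mk.2 h]

/-- Once every child is replaced by the chosen representative of its class, equal multisets of
classes give lists that are permutations of each other. -/
theorem iso_node_of_children_eq (c : Fin N) {l l' : List (OTree N)}
    (h : children (node c l) = children (node c l')) : Iso (node c l) (node c l') := by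
  have key : ∀ l : List (OTree N), Iso (node c l)
      (node c ((l.map NTree.mk).map NTree.out)) := by
    intro l
    have := iso_node_of_forall₂ c (l := l) (l' := (l.map NTree.mk).map NTree.out) ?_ []
    · simpa using this
    · rw [List.map_map, List.forall₂_map_right_iff]
      exact List.forall₂_same.2 fun t _ => NTree.mk_eq_mk.1 (NTree.mk_out _).symm
  refine (key l).trans (Iso.trans (Iso.perm c ?_) (key l').symm)
  exact (Multiset.coe_eq_coe.1 h).map _

end OTree

namespace NTree

variable {N : ℕ} {E : Type*} [NormedAddCommGroup E] [NormedSpace ℝ E]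

/-- The colour of the root. -/
def root (τ : NTree N) : Fin N := Quotient.lift OTree.root (fun _ _ h => OTree.root_congr h) τ

/-- The children of the root, with multiplicity. -/
def children (τ : NTree N) : Multiset (NTree N) :=
  Quotient.lift OTree.children (fun _ _ h => OTree.children_congr h) τ

theorem ext_root_children {τ τ' : NTree N} (h : τ.root = τ'.root)
    (h' : τ.children = τ'.children) : τ = τ' := by
  induction τ using Quotient.ind with | _ t =>
  induction τ' using Quotient.ind with | _ t' =>
  obtain ⟨c, l⟩ := t
  obtain ⟨c', l'⟩ := t'
  obtain rfl : c = c' := h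
  exact Quotient.sound (OTree.iso_node_of_children_eq c h')

theorem order_eq (τ : NTree N) : τ.order = 1 + (τ.children.map order).sum := by
  induction τ using Quotient.ind with | _ t =>
  obtain ⟨c, l⟩ := t
  change OTree.order (.node c l) = 1 + (((l.map mk).map order).sum)
  rw [OTree.order, OTree.orderSum_eq, List.map_map]
  rfl

theorem density_eq (τ : NTree N) : τ.density = τ.order * (τ.children.map density).prod := by
  induction τ using Quotient.ind with | _ t =>
  obtain ⟨c, l⟩ := t
  change OTree.density (.node c l) =
    OTree.order (.node c l) * ((l.map mk).map density).prod
  rw [OTree.density, OTree.order, OTree.densityProd_eq, List.map_map]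
  rfl

theorem symmetry_eq (τ : NTree N) :
    τ.symmetry = OTree.multFactorial τ.children * (τ.children.map symmetry).prod := by
  induction τ using Quotient.ind with | _ t =>
  obtain ⟨c, l⟩ := t
  change OTree.symmetry (.node c l) =
    OTree.multFactorial (OTree.classes l) * ((l.map mk).map symmetry).prod
  rw [OTree.symmetry, OTree.symmetryProd_eq, List.map_map]
  rfl

theorem one_le_order (τ : NTree N) : 1 ≤ τ.order := by rw [order_eq]; omega

theorem order_lt_of_mem_children {σ τ : NTree N} (h : σ ∈ τ.children) : σ.order < τ.order := by
  rw [order_eq τ]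
  have := Multiset.single_le_sum (fun x _ => Nat.zero_le x) _ (Multiset.mem_map_of_mem order h)
  omega

theorem card_children_lt_order (τ : NTree N) : τ.children.card < τ.order := by
  rw [order_eq τ]
  have : τ.children.card • 1 ≤ (τ.children.map order).sum := by
    rw [← Multiset.card_map order]
    refine Multiset.card_nsmul_le_sum fun x hx => ?_
    obtain ⟨σ, _, rfl⟩ := Multiset.mem_map.1 hx
    exact one_le_order σ
  simp at this
  omega

/-- The recursion of elementary differentials on isomorphism classes, valid for any listing `r` of
the children; this freedom lets it be applied to the tuples of the Taylor expansion. -/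
theorem elemDiff_eq {f : Fin N → E → E} {y : E} {n : ℕ} (hf : ∀ c, ContDiffAt ℝ n (f c) y)
    {τ : NTree N} (hτ : τ.order ≤ n + 1) {r : List (NTree N)} (hr : ↑r = τ.children) :
    τ.elemDiff f y = dirDeriv (f τ.root) (r.map fun σ => σ.elemDiff f y) y := by
  have h : OTree.Iso τ.out (.node τ.root (r.map out)) := by
    rw [← mk_eq_mk, mk_out]
    refine ext_root_children rfl ?_
    change τ.children = ((r.map out).map mk : List (NTree N))
    rw [← hr, List.map_map, (funext mk_out : mk ∘ out = id), List.map_id]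
  have ho : OTree.order τ.out = τ.order := by
    conv_rhs => rw [← mk_out τ]
    rfl
  change OTree.elemDiff f y τ.out = _
  rw [OTree.elemDiff_congr hf h (ho ▸ hτ), OTree.elemDiff_node, List.map_map]
  rfl

/-- The tree with root colour `c` and children `m`. -/
def node (c : Fin N) (m : Multiset (NTree N)) : NTree N := mk (.node c (m.toList.map out))

@[simp] theorem root_node (c : Fin N) (m : Multiset (NTree N)) : (node c m).root = c := rfl

@[simp] theorem children_node (c : Fin N) (m : Multiset (NTree N)) : (node c m).children = m := by
  change (((m.toList.map out).map mk : List (NTree N)) : Multiset (NTree N)) = m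
  rw [List.map_map, (funext mk_out : mk ∘ out = id), List.map_id, Multiset.coe_toList]

end NTree

/-! ### Counting tuples with a prescribed multiset of entries -/

section Counting

variable {α : Type*}

open Classical in
theorem OTree.multFactorial_eq_prod (m : Multiset α) {T : Finset α} (hT : m.toFinset ⊆ T) :
    OTree.multFactorial m = ∏ a ∈ T, (m.count a)! := by
  rw [OTree.multFactorial]
  refine Finset.prod_subset hT fun a _ ha => ?_
  rw [Multiset.count_eq_zero_of_notMem (by simpa using ha), Nat.factorial_zero]

open Classical in
theorem OTree.multFactorial_erase {m : Multiset α} {a : α} (ha : a ∈ m) :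
    OTree.multFactorial m = m.count a * OTree.multFactorial (m.erase a) := by
  have ha' : a ∈ m.toFinset := by simpa using ha
  rw [OTree.multFactorial_eq_prod m subset_rfl, OTree.multFactorial_eq_prod (m.erase a)
    (T := m.toFinset) (fun b hb => by
      simp only [Multiset.mem_toFinset] at hb ⊢; exact Multiset.mem_of_mem_erase hb),
    ← Finset.mul_prod_erase _ _ ha', ← Finset.mul_prod_erase _ _ ha', ← mul_assoc,
    Multiset.count_erase_self, Nat.mul_factorial_pred (Multiset.count_ne_zero.2 ha)]
  congr 1
  refine Finset.prod_congr rfl fun b hb => ?_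
  rw [Multiset.count_erase_of_ne (Finset.ne_of_mem_erase hb)]

theorem OTree.multFactorial_pos (m : Multiset α) : 0 < OTree.multFactorial m :=
  Finset.prod_pos fun _ _ => Nat.factorial_pos _

open Classical in
-- The multinomial count l!/∏ mₖ!. Fixing the first entry `a` leaves the count for `m.erase a`; the
-- resulting weights `m.count a` add up to the cardinality of `m`.
theorem card_tuples_mul_multFactorial (S : Finset α) (l : ℕ) (m : Multiset α)
    (hm : ∀ a ∈ m, a ∈ S) (hl : m.card = l) :
    (∑ r : Fin l → S, if ((List.ofFn fun i => (r i : α) : List α) : Multiset α) = m then 1 else 0)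
      * OTree.multFactorial m = l ! := by
  induction l generalizing m with
  | zero =>
      obtain rfl := Multiset.card_eq_zero.1 hl
      simp [OTree.multFactorial]
  | succ l ih =>
      rw [← (Fin.consEquiv fun _ : Fin (l + 1) => (S : Type _)).sum_comp, Fintype.sum_prod_type,
        Finset.sum_mul]
      have key : ∀ a : S, (∑ r : Fin l → S,
          if ((List.ofFn fun i => ((Fin.consEquiv fun _ : Fin (l + 1) => (S : Type _)) (a, r) i : α)
            : List α) : Multiset α) = m then 1 else 0) * OTree.multFactorial m
          = m.count (a : α) * l ! := by
        intro a
        by_cases ha : (a : α) ∈ m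
        · rw [OTree.multFactorial_erase ha, ← ih (m.erase a)
            (fun b hb => hm b (Multiset.mem_of_mem_erase hb))
            (by rw [Multiset.card_erase_of_mem ha, hl]; rfl), mul_left_comm]
          congr 2
          refine Finset.sum_congr rfl fun r _ => ?_
          congr 1
          simp only [Fin.consEquiv_apply, List.ofFn_succ, Fin.cons_zero, Fin.cons_succ,
            ← Multiset.cons_coe, eq_iff_iff]
          constructor
          · rintro rfl; simp
          · intro h; rw [h, Multiset.cons_erase ha]
        · rw [Multiset.count_eq_zero_of_notMem ha, Finset.sum_eq_zero, zero_mul, zero_mul]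
          intro r _
          rw [if_neg]
          rintro rfl
          simp [Fin.consEquiv_apply, List.ofFn_succ] at ha
      rw [Finset.sum_congr rfl fun a _ => key a, ← Finset.sum_mul, Nat.factorial_succ]
      congr 1
      rw [Finset.sum_coe_sort S fun a => m.count a, ← hl]
      exact Multiset.sum_count_eq_card hm

end Counting

/-! ### Taylor expansion -/

section Taylor

variable {E F : Type*} [NormedAddCommGroup E] [NormedSpace ℝ E]
  [NormedAddCommGroup F] [NormedSpace ℝ F]

@[simp] theorem dirDeriv_nil (f : E → F) (x : E) : dirDeriv f [] x = f x := rfl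

theorem dirDeriv_ofFn (f : E → F) (x : E) {l : ℕ} (r : Fin l → E) :
    dirDeriv f (List.ofFn r) x = iteratedFDeriv ℝ l f x r := by
  have key : ∀ (L : List E) (h : L.length = l),
      dirDeriv f L x = iteratedFDeriv ℝ l f x fun i => L.get (i.cast h.symm) := by
    rintro L rfl; rfl
  rw [key _ (List.length_ofFn)]
  congr 1
  ext i
  simp

theorem dirDeriv_replicate (f : E → F) (x v : E) (l : ℕ) :
    dirDeriv f (List.replicate l v) x = iteratedFDeriv ℝ l f x fun _ => v := by
  rw [← dirDeriv_ofFn, List.ofFn_const]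

/-- Taylor's remainder without integrals: the derivative of the remainder is the remainder of the
shifted chain g 1, g 2, …, so the mean value inequality carries the bound up. The factor 1/n! is
given away. -/
theorem norm_sub_sum_derivs_le {C : ℝ} (n : ℕ) (g : ℕ → ℝ → F)
    (hg : ∀ k < n, ∀ t ∈ Set.Icc (0 : ℝ) 1, HasDerivAt (g k) (g (k + 1) t) t)
    (hC : ∀ t ∈ Set.Icc (0 : ℝ) 1, ‖g n t‖ ≤ C) (t : ℝ) (ht : t ∈ Set.Icc (0 : ℝ) 1) :
    ‖g 0 t - ∑ k ∈ Finset.range n, (t ^ k / (k ! : ℝ)) • g k 0‖ ≤ C := by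
  induction n generalizing g t with
  | zero => simpa using hC t ht
  | succ n ih =>
      have h0 : 0 ≤ C := (norm_nonneg _).trans (hC t ht)
      have ih' := ih (fun k => g (k + 1)) (fun k hk => hg (k + 1) (by omega)) hC
      have hd : ∀ t ∈ Set.Icc (0 : ℝ) 1, HasDerivAt
          (fun t => g 0 t - ∑ k ∈ Finset.range (n + 1), (t ^ k / (k ! : ℝ)) • g k 0)
          (g 1 t - ∑ k ∈ Finset.range n, (t ^ k / (k ! : ℝ)) • g (k + 1) 0) t := by
        intro t ht
        refine (hg 0 (by omega) t ht).sub ?_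
        simp_rw [Finset.sum_range_succ' _ n]
        simp only [pow_zero]
        refine HasDerivAt.add_const _ (HasDerivAt.fun_sum fun k _ => ?_)
        have h := ((hasDerivAt_pow (k + 1) t).div_const ((k + 1)! : ℝ)).smul_const (g (k + 1) 0)
        convert h using 2
        rw [Nat.factorial_succ]
        push_cast
        have : (k ! : ℝ) ≠ 0 := by positivity
        field_simp
      have := norm_image_sub_le_of_norm_deriv_le_segment'
        (fun x hx => (hd x hx).hasDerivWithinAt) (fun x hx => ih' x ⟨hx.1, hx.2.le⟩) t ht
      simp only [Finset.sum_range_succ' _ n] at this ⊢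
      simp only [pow_zero, Nat.factorial_zero, Nat.cast_one, div_one, one_smul, ne_eq,
        Nat.succ_ne_zero, not_false_eq_true, zero_pow, zero_div, zero_smul, Finset.sum_const_zero,
        zero_add, sub_self, sub_zero] at this ⊢
      exact this.trans (mul_le_of_le_one_right h0 ht.2)

/-- Taylor's formula in several variables. -/
theorem taylor_isBigO {f : E → F} {x : E} {n : ℕ} (hf : ContDiffAt ℝ n f x) :
    (fun v => f (x + v) - ∑ l ∈ Finset.range n, (1 / (l ! : ℝ)) •
      dirDeriv f (List.replicate l v) x) =O[𝓝 0] fun v => ‖v‖ ^ n := by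
  have hcont : ContinuousAt (iteratedFDeriv ℝ n f) x :=
    (ContDiffAt.iteratedFDeriv_right (m := 0) (i := n) hf (by simp)).continuousAt
  have hbd : ∀ᶠ z in 𝓝 x, ‖iteratedFDeriv ℝ n f z‖ ≤ ‖iteratedFDeriv ℝ n f x‖ + 1 :=
    (hcont.norm.eventually (gt_mem_nhds (lt_add_one _))).mono fun _ h => h.le
  obtain ⟨ε, hε, hball⟩ := Metric.eventually_nhds_iff_ball.1
    (hbd.and (hf.eventually (by simp)))
  refine IsBigO.of_bound (‖iteratedFDeriv ℝ n f x‖ + 1) ?_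
  filter_upwards [Metric.ball_mem_nhds (0 : E) hε] with v hv
  have hmem : ∀ t ∈ Set.Icc (0 : ℝ) 1, x + t • v ∈ Metric.ball x ε := by
    intro t ht
    rw [mem_ball_zero_iff] at hv
    rw [mem_ball_iff_norm, add_sub_cancel_left, norm_smul, Real.norm_of_nonneg ht.1]
    exact (mul_le_of_le_one_left (norm_nonneg v) ht.2).trans_lt hv
  -- Restriction to the segment from x to x + v: the k-th derivative of t ↦ f(x + tv) is the
  -- derivative in k copies of v.
  have h := norm_sub_sum_derivs_le (C := (‖iteratedFDeriv ℝ n f x‖ + 1) * ‖v‖ ^ n) n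
    (fun k t => dirDeriv f (List.replicate k v) (x + t • v)) ?_ ?_ 1 (by simp)
  · simpa using h
  · intro k hk t ht
    have hz := (hball _ (hmem t ht)).2
    have hk' : ContDiffAt ℝ ((((List.replicate k v).length + 1 : ℕ)) : WithTop ℕ∞) f (x + t • v) := by
      refine hz.of_le ?_
      rw [List.length_replicate]
      exact_mod_cast hk
    have hd : DifferentiableAt ℝ (dirDeriv f (List.replicate k v)) (x + t • v) :=
      (ContDiffAt.dirDeriv (n := 1) _ hk').differentiableAt (by simp)
    simp only [List.replicate_succ]
    rw [dirDeriv_cons hk']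
    have hl : HasDerivAt (fun t : ℝ => x + t • v) v t := by
      simpa using ((hasDerivAt_id t).smul_const v).const_add x
    exact hd.hasFDerivAt.comp_hasDerivAt t hl
  · intro t ht
    rw [dirDeriv_replicate]
    refine (ContinuousMultilinearMap.le_opNorm _ _).trans ?_
    rw [Finset.prod_const, Finset.card_univ, Fintype.card_fin]
    gcongr
    exact (hball _ (hmem t ht)).1

end Taylor

/-! ### The series of the exact solution -/

namespace NTree

variable {N : ℕ} {E : Type*} [NormedAddCommGroup E] [NormedSpace ℝ E]

/-- The coefficient `1 / (σ(τ) γ(τ))` of the exact solution. -/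
def exactCoeff (τ : NTree N) : ℝ := 1 / (τ.symmetry : ℝ) * (1 / (τ.density : ℝ))

theorem mem_upTo {p : ℕ} {τ : NTree N} : τ ∈ upTo N p ↔ τ.order ≤ p := by
  simp [upTo]

/-- The recursion that makes the series solve the equation: the left side comes from differentiating
t^|τ|, the right side from the Taylor expansion of f. -/
theorem order_mul_exactCoeff (τ : NTree N) :
    (τ.order : ℝ) * τ.exactCoeff
      = 1 / (OTree.multFactorial τ.children : ℝ) * (τ.children.map exactCoeff).prod := by
  have h : (τ.children.map exactCoeff).prod
      = 1 / ((τ.children.map symmetry).prod : ℕ) * (1 / ((τ.children.map density).prod : ℕ)) := by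
    unfold exactCoeff
    rw [Multiset.prod_map_mul]
    congr 1 <;> simp [Nat.cast_multiset_prod, Multiset.map_map]
  rw [h, exactCoeff]
  have ho : (τ.order : ℝ) ≠ 0 := by exact_mod_cast (Nat.pos_iff_ne_zero.1 (one_le_order τ))
  conv_lhs => rw [symmetry_eq, density_eq]
  push_cast
  field_simp

/-- Passage from ordered tuples to trees: τ with l children arises from l!/∏ mₖ! tuples. The range l
< q loses nothing, since a tree has fewer children than nodes. -/
theorem sum_tuples_smul [DecidableEq (NTree N)] (q : ℕ) (G : NTree N → E) :
    ∑ ν : Fin N, ∑ l ∈ Finset.range q, ∑ r : Fin l → upTo N q,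
      (if (node ν (List.ofFn fun i => (r i : NTree N))).order ≤ q then
        (1 / (l ! : ℝ)) • G (node ν (List.ofFn fun i => (r i : NTree N))) else 0)
      = ∑ τ ∈ upTo N q, (1 / (OTree.multFactorial τ.children : ℝ)) • G τ := by
  have h1 : ∀ (ν : Fin N) (l : ℕ) (r : Fin l → upTo N q),
      (if (node ν (List.ofFn fun i => (r i : NTree N))).order ≤ q then
        (1 / (l ! : ℝ)) • G (node ν (List.ofFn fun i => (r i : NTree N))) else 0)
      = ∑ τ ∈ upTo N q, (if node ν (List.ofFn fun i => (r i : NTree N)) = τ then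
          (1 / (l ! : ℝ)) else 0) • G τ := by
    intro ν l r
    simp only [ite_smul, zero_smul]
    rw [Finset.sum_ite_eq]
    simp only [mem_upTo]
  simp_rw [h1]
  simp_rw [Finset.sum_comm (t := upTo N q)]
  refine Finset.sum_congr rfl fun τ hτ => ?_
  simp_rw [← Finset.sum_smul]
  congr 1
  have hcard : τ.children.card ∈ Finset.range q :=
    Finset.mem_range.2 ((card_children_lt_order τ).trans_le (mem_upTo.1 hτ))
  have hiff : ∀ (ν : Fin N) (l : ℕ) (r : Fin l → upTo N q),
      node ν (List.ofFn fun i => (r i : NTree N)) = τ ↔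
        ν = τ.root ∧ ((List.ofFn fun i => (r i : NTree N) : List (NTree N)) :
          Multiset (NTree N)) = τ.children := by
    intro ν l r
    constructor
    · rintro rfl; simp
    · rintro ⟨h, h'⟩; exact ext_root_children (by simpa using h) (by simpa using h')
  rw [Finset.sum_eq_single τ.root, Finset.sum_eq_single_of_mem _ hcard]
  · have h := card_tuples_mul_multFactorial (upTo N q) τ.children.card τ.children
      (fun σ hσ => mem_upTo.2 ((order_lt_of_mem_children hσ).le.trans (mem_upTo.1 hτ))) rfl
    have hpos : (OTree.multFactorial τ.children : ℝ) ≠ 0 := by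
      exact_mod_cast (OTree.multFactorial_pos τ.children).ne'
    have hl : ((τ.children.card)! : ℝ) ≠ 0 := by positivity
    simp only [hiff, true_and]
    rw [eq_div_iff hpos, ← mul_right_inj' hl, mul_one]
    conv_rhs => rw [← h]
    push_cast
    rw [← mul_assoc, Finset.mul_sum]
    congr 1
    refine Finset.sum_congr rfl fun r _ => ?_
    rw [mul_ite, mul_one_div_cancel hl, mul_zero]
  · intro l _ hl
    refine Finset.sum_eq_zero fun r _ => if_neg fun h => hl ?_
    rw [← ((hiff _ _ _).1 h).2]
    simp
  · intro ν _ hν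
    exact Finset.sum_eq_zero fun l _ => Finset.sum_eq_zero fun r _ =>
      if_neg fun h => hν ((hiff _ _ _).1 h).1
  · simp

theorem dirDeriv_replicate_sum {F : Type*} [NormedAddCommGroup F] [NormedSpace ℝ F]
    {α : Type*} (S : Finset α) (f : E → F) (y : E) (c : α → ℝ) (v : α → E) (l : ℕ) :
    dirDeriv f (List.replicate l (∑ a ∈ S, c a • v a)) y
      = ∑ r : Fin l → S, (∏ i, c (r i)) • dirDeriv f (List.ofFn fun i => v (r i)) y := by
  rw [dirDeriv_replicate, ← Finset.sum_coe_sort S fun a => c a • v a,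
    ContinuousMultilinearMap.map_sum]
  refine Finset.sum_congr rfl fun r _ => ?_
  rw [ContinuousMultilinearMap.map_smul_univ, dirDeriv_ofFn]

/-- The defect of the truncated series, whose termwise derivative is the second sum. -/
theorem isBigO_expansion {q : ℕ} {f : Fin N → E → E} {y : E}
    (hf : ∀ ν, ContDiffAt ℝ q (f ν) y) :
    (fun t : ℝ => ∑ ν, f ν (y + ∑ τ ∈ upTo N q, (t ^ τ.order * τ.exactCoeff) • τ.elemDiff f y)
        - ∑ τ ∈ upTo N q, (τ.order * t ^ (τ.order - 1) * τ.exactCoeff) • τ.elemDiff f y)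
      =O[𝓝 0] fun t => t ^ q := by
  classical
  set Δ : ℝ → E := fun t => ∑ τ ∈ upTo N q, (t ^ τ.order * τ.exactCoeff) • τ.elemDiff f y with hΔ
  have hpow : ∀ n m : ℕ, n ≤ m → (fun t : ℝ => t ^ m) =O[𝓝 0] fun t => t ^ n := by
    intro n m hnm
    obtain ⟨k, rfl⟩ := Nat.exists_eq_add_of_le hnm
    have : (fun t : ℝ => t ^ k) =O[𝓝 0] fun _ => (1 : ℝ) :=
      (continuous_pow k).continuousAt.isBigO_one ℝ
    simpa [pow_add] using (isBigO_refl (fun t : ℝ => t ^ n) (𝓝 0)).mul this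
  have hpow' : ∀ (n m : ℕ) (v : E) (c : ℝ), n ≤ m →
      (fun t : ℝ => (t ^ m * c) • v) =O[𝓝 0] fun t => t ^ n := by
    intro n m v c hnm
    have := ((hpow n m hnm).mul (isBigO_const_const c one_ne_zero (𝓝 (0 : ℝ)))).smul
      (isBigO_const_const v (one_ne_zero (α := ℝ)) (𝓝 (0 : ℝ)))
    simpa using this
  have hΔO : Δ =O[𝓝 0] fun t : ℝ => t := by
    refine IsBigO.fun_sum fun τ _ => ?_
    simpa using hpow' 1 τ.order (τ.elemDiff f y) τ.exactCoeff (one_le_order τ)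
  have hΔ0 : Tendsto Δ (𝓝 0) (𝓝 0) := hΔO.trans_tendsto tendsto_id
  -- Taylor expansion of each `f ν`
  have hT : ∀ ν, (fun t => f ν (y + Δ t) - ∑ l ∈ Finset.range q, (1 / (l ! : ℝ)) •
      dirDeriv (f ν) (List.replicate l (Δ t)) y) =O[𝓝 0] fun t : ℝ => t ^ q := fun ν =>
    ((taylor_isBigO (hf ν)).comp_tendsto hΔ0).trans (hΔO.norm_left.pow q)
  have hS := IsBigO.fun_sum (s := Finset.univ) fun ν _ => hT ν
  -- the terms that belong to trees with at most `q` nodes, and the others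
  set G : ℝ → NTree N → E := fun t τ =>
    (t ^ (τ.order - 1) * (τ.children.map exactCoeff).prod) • τ.elemDiff f y with hG
  have hR : (fun t => ∑ ν, ∑ l ∈ Finset.range q, ∑ r : Fin l → upTo N q,
      ((1 / (l ! : ℝ)) • (∏ i, (t ^ (r i : NTree N).order * (r i : NTree N).exactCoeff)) •
          dirDeriv (f ν) (List.ofFn fun i => (r i : NTree N).elemDiff f y) y
        - (if (node ν (List.ofFn fun i => (r i : NTree N))).order ≤ q then
        (1 / (l ! : ℝ)) • G t (node ν (List.ofFn fun i => (r i : NTree N))) else 0)))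
      =O[𝓝 0] fun t : ℝ => t ^ q := by
    refine IsBigO.fun_sum fun ν _ => IsBigO.fun_sum fun l _ => IsBigO.fun_sum fun r _ => ?_
    set τ := node ν (List.ofFn fun i => (r i : NTree N)) with hτ
    have ho : ∑ i, (r i : NTree N).order = τ.order - 1 := by
      rw [order_eq, hτ, children_node, Multiset.map_coe, Multiset.sum_coe, List.map_ofFn,
        List.sum_ofFn]
      simp
    have hc : ∏ i, (r i : NTree N).exactCoeff = (τ.children.map exactCoeff).prod := by
      rw [hτ, children_node, Multiset.map_coe, Multiset.prod_coe, List.map_ofFn,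
        List.prod_ofFn]
      simp
    simp_rw [Finset.prod_mul_distrib, Finset.prod_pow_eq_pow_sum, ho, hc]
    split_ifs with h
    · have he : dirDeriv (f ν) (List.ofFn fun i => (r i : NTree N).elemDiff f y) y
          = τ.elemDiff f y := by
        rw [elemDiff_eq hf (h.trans (Nat.le_succ q)) (children_node _ _).symm, List.map_ofFn]
        rfl
      simp only [he, hG, sub_self]
      exact isBigO_zero _ _
    -- Trees with more than q nodes are not matched by the series, but their power t^(|τ| - 1) is
    -- already O(t^q).
    · simp only [sub_zero]
      exact (hpow' q _ _ _ (by omega)).const_smul_left _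
  refine (hS.add hR).congr_left fun t => ?_
  have hsum := sum_tuples_smul q (G t)
  simp only [Finset.sum_sub_distrib] at hsum ⊢
  rw [hsum]
  have hD : ∀ ν l, dirDeriv (f ν) (List.replicate l (Δ t)) y
      = ∑ r : Fin l → upTo N q, (∏ i, (t ^ (r i : NTree N).order * (r i : NTree N).exactCoeff)) •
          dirDeriv (f ν) (List.ofFn fun i => (r i : NTree N).elemDiff f y) y := fun ν l =>
    dirDeriv_replicate_sum _ _ _ (fun τ : NTree N => t ^ τ.order * τ.exactCoeff)
      (fun τ => τ.elemDiff f y) l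
  simp_rw [hD, Finset.smul_sum]
  have hP : ∑ τ ∈ upTo N q, (1 / (OTree.multFactorial τ.children : ℝ)) • G t τ
      = ∑ τ ∈ upTo N q, (τ.order * t ^ (τ.order - 1) * τ.exactCoeff) • τ.elemDiff f y := by
    refine Finset.sum_congr rfl fun τ _ => ?_
    rw [hG, smul_smul]
    congr 1
    rw [mul_right_comm, order_mul_exactCoeff]
    ring
  rw [hP]
  abel

end NTree

-- From defect to error for differential equations

section ODE

variable {E : Type*} [NormedAddCommGroup E] [NormedSpace ℝ E]

/-- The mean value inequality on the ball of radius |t| gains one power of t. -/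
theorem isBigO_pow_succ_of_hasDerivAt {e e' : ℝ → E} {k : ℕ} (h0 : e 0 = 0)
    (he : ∀ᶠ t in 𝓝 (0 : ℝ), HasDerivAt e (e' t) t) (h : e' =O[𝓝 0] fun t => t ^ k) :
    e =O[𝓝 0] fun t => t ^ (k + 1) := by
  obtain ⟨C, hC⟩ := h.bound
  obtain ⟨ε, hε, hball⟩ := Metric.eventually_nhds_iff_ball.1 (he.and hC)
  refine IsBigO.of_bound C ?_
  filter_upwards [Metric.ball_mem_nhds (0 : ℝ) hε] with t ht
  rw [mem_ball_zero_iff] at ht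
  have hmem : ∀ x ∈ Metric.closedBall (0 : ℝ) ‖t‖, x ∈ Metric.ball (0 : ℝ) ε := fun x hx =>
    mem_ball_zero_iff.2 ((mem_closedBall_zero_iff.1 hx).trans_lt ht)
  -- The constant behind the O-bound could be negative, but the bound at a point t ≠ 0 rules this
  -- out.
  have hC0 : 0 ≤ C ∨ t = 0 := by
    by_contra! hcon
    have h1 := (hball t (hmem t (by simp))).2
    have h2 : 0 < ‖t ^ k‖ := norm_pos_iff.2 (pow_ne_zero k hcon.2)
    nlinarith [norm_nonneg (e' t), mul_neg_of_neg_of_pos hcon.1 h2]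
  rcases hC0 with hC0 | rfl
  · have := Convex.norm_image_sub_le_of_norm_hasDerivWithin_le (f := e) (f' := e')
      (s := Metric.closedBall (0 : ℝ) ‖t‖) (C := C * ‖t‖ ^ k) (x := 0) (y := t)
      (fun x hx => (hball x (hmem x hx)).1.hasDerivWithinAt)
      (fun x hx => (hball x (hmem x hx)).2.trans (by
        rw [norm_pow]
        have := mem_closedBall_zero_iff.1 hx
        gcongr)) (convex_closedBall _ _) (by simp) (by simp)
    rw [h0, sub_zero, sub_zero, mul_assoc, ← pow_succ, ← norm_pow] at this
    exact this
  · simp [h0]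

/-- If `z` satisfies `y' = g(y)` up to a defect `O(t ^ q)`, then it differs from the solution with
the same initial value by `O(t ^ (q + 1))`. -/
theorem IsLocalSolution.sub_isBigO {g : E → E} {y₀ : E} {y z z' : ℝ → E} {q : ℕ}
    (hg : ContDiffAt ℝ 1 g y₀) (hy : IsLocalSolution g y₀ y) (hz0 : z 0 = y₀)
    (hz : ∀ t, HasDerivAt z (z' t) t)
    (hdef : (fun t => g (z t) - z' t) =O[𝓝 0] fun t : ℝ => t ^ q) :
    (fun t => y t - z t) =O[𝓝 0] fun t => t ^ (q + 1) := by
  have hyt : Tendsto y (𝓝 0) (𝓝 y₀) := by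
    rw [← hy.1]; exact hy.2.self_of_nhds.continuousAt
  have hzt : Tendsto z (𝓝 0) (𝓝 y₀) := by
    rw [← hz0]; exact (hz 0).continuousAt
  have hlip : (fun t => g (y t) - g (z t)) =O[𝓝 0] fun t => y t - z t :=
    (hg.hasStrictFDerivAt (by simp)).isBigO_sub.comp_tendsto (hyt.prodMk_nhds hzt)
  have hder : ∀ᶠ t in 𝓝 (0 : ℝ), HasDerivAt (fun t => y t - z t) (g (y t) - z' t) t :=
    hy.2.mono fun t ht => ht.sub (hz t)
  -- Bootstrapping in place of Grönwall: by the Lipschitz bound, an error O(t^k) has derivative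
  -- O(t^k) as long as k ≤ q, hence is O(t^(k+1)).
  have key : ∀ k ≤ q + 1, (fun t => y t - z t) =O[𝓝 0] fun t => t ^ k := by
    intro k hk
    induction k with
    | zero =>
        simpa using (hyt.sub hzt).isBigO_one ℝ
    | succ k ih =>
        refine isBigO_pow_succ_of_hasDerivAt (by rw [hy.1, hz0, sub_self]) hder ?_
        have hq : (fun t : ℝ => t ^ q) =O[𝓝 0] fun t => t ^ k :=
          IsBigO.of_bound 1 (by
            filter_upwards [Metric.ball_mem_nhds (0 : ℝ) one_pos] with t ht
            rw [mem_ball_zero_iff] at ht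
            rw [norm_pow, norm_pow, one_mul]
            exact pow_le_pow_of_le_one (norm_nonneg t) ht.le (by omega))
        exact ((hlip.trans (ih (by omega))).add (hdef.trans hq)).congr_left fun t => by abel
  exact key _ le_rfl

/-- The exact solution agrees with its truncated series. -/
theorem IsLocalSolution.sub_NBseries_isBigO {N : ℕ} {f : Fin N → E → E} {y₀ : E} {y : ℝ → E}
    {q : ℕ} (hq : 1 ≤ q) (hf : ∀ ν, ContDiffAt ℝ q (f ν) y₀)
    (hy : IsLocalSolution (fun x => ∑ ν, f ν x) y₀ y) :
    (fun t => y t - NBseries f q (fun τ => 1 / (τ.density : ℝ)) y₀ t 1)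
      =O[𝓝 0] fun t => t ^ (q + 1) := by
  have hN : ∀ t, NBseries f q (fun τ => 1 / (τ.density : ℝ)) y₀ t 1
      = y₀ + ∑ τ ∈ NTree.upTo N q, (t ^ τ.order * τ.exactCoeff) • τ.elemDiff f y₀ := by
    intro t
    rw [NBseries]
    congr 1
    refine Finset.sum_congr rfl fun τ _ => ?_
    rw [NTree.exactCoeff, one_mul]
    congr 1
    ring
  simp_rw [hN]
  refine IsLocalSolution.sub_isBigO (q := q) ?_ hy ?_ ?_ (NTree.isBigO_expansion hf)
  · exact ContDiffAt.sum fun ν _ => (hf ν).of_le (by exact_mod_cast hq)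
  · rw [add_eq_left]
    refine Finset.sum_eq_zero fun τ _ => ?_
    rw [zero_pow (Nat.pos_iff_ne_zero.1 τ.one_le_order), zero_mul, zero_smul]
  · intro t
    refine HasDerivAt.const_add _ (HasDerivAt.fun_sum fun τ _ => ?_)
    exact ((hasDerivAt_pow τ.order t).mul_const _).smul_const _

end ODE

-- Existence and stability of Runge–Kutta stages

section Stages

variable {E : Type*} [NormedAddCommGroup E] [NormedSpace ℝ E] [FiniteDimensional ℝ E]

/-- For small step sizes there are Runge–Kutta stages near the initial value, and approximate
stages differ from them at most by a multiple of their defect. -/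
theorem exists_isRKStages {s : ℕ} (A : Fin s → Fin s → ℝ) {g : E → E} {y₀ : E}
    (hg : ContDiffAt ℝ 1 g y₀) :
    ∃ Z : ℝ → Fin s → E, (∀ᶠ h in 𝓝[>] (0 : ℝ), IsRKStages A g y₀ h (Z h)) ∧
      Tendsto Z (𝓝[>] 0) (𝓝 fun _ => y₀) ∧
      ∀ Y : ℝ → Fin s → E, Tendsto Y (𝓝[>] 0) (𝓝 fun _ => y₀) →
        (fun h => Y h - Z h) =O[𝓝[>] (0 : ℝ)]
          fun h => Y h - fun i => y₀ + h • ∑ j, A i j • g (Y h j) := by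
  have : CompleteSpace E := FiniteDimensional.complete ℝ E
  obtain ⟨L, S, hS, hL⟩ := hg.exists_lipschitzOnWith
  -- `g` is Lipschitz only near `y₀`. A global Lipschitz extension makes the stage map a contraction
  -- of the whole space; it agrees with `g` along stages tending to `y₀`.
  obtain ⟨G, hG, hGg⟩ := hL.extend_finite_dimension
  set L' := lipschitzExtensionConstant E * L
  have hloc : ∀ Y : ℝ → Fin s → E, Tendsto Y (𝓝[>] 0) (𝓝 fun _ => y₀) →
      ∀ᶠ h in 𝓝[>] (0 : ℝ), ∀ j, g (Y h j) = G (Y h j) := by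
    intro Y hY
    refine eventually_all.2 fun j => ?_
    filter_upwards [(tendsto_pi_nhds.1 hY j).eventually hS] with h hh using hGg hh
  set Φ : (Fin s → E) → Fin s → E := fun W i => ∑ j, A i j • G (W j) with hΦ
  set K : ℝ := ∑ i, ∑ j, |A i j| * L' with hK
  have hK0 : 0 ≤ K := by positivity
  have hΦlip : ∀ W W', ‖Φ W - Φ W'‖ ≤ K * ‖W - W'‖ := by
    intro W W'
    refine (pi_norm_le_iff_of_nonneg (by positivity)).2 fun i => ?_
    simp only [hΦ, Pi.sub_apply, ← Finset.sum_sub_distrib, ← smul_sub]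
    calc ‖∑ j, A i j • (G (W j) - G (W' j))‖ ≤ ∑ j, |A i j| * L' * ‖W - W'‖ := by
          refine norm_sum_le_of_le _ fun j _ => ?_
          rw [norm_smul, Real.norm_eq_abs, mul_assoc]
          have := hG.norm_sub_le (W j) (W' j)
          have h2 := norm_le_pi_norm (W - W') j
          rw [Pi.sub_apply] at h2
          exact mul_le_mul_of_nonneg_left (this.trans
            (mul_le_mul_of_nonneg_left h2 L'.coe_nonneg)) (abs_nonneg _)
      _ ≤ K * ‖W - W'‖ := by
          rw [← Finset.sum_mul]
          refine mul_le_mul_of_nonneg_right ?_ (norm_nonneg _)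
          exact Finset.single_le_sum (f := fun i => ∑ j, |A i j| * (L' : ℝ))
            (fun i _ => by positivity) (Finset.mem_univ i)
  set T : ℝ → (Fin s → E) → Fin s → E := fun h W => (fun _ => y₀) + h • Φ W with hT
  have hsmall : ∀ᶠ h in 𝓝[>] (0 : ℝ), 0 < h ∧ h * K ≤ 1 / 2 := by
    have h1 : Tendsto (fun h : ℝ => h * K) (𝓝[>] 0) (𝓝 0) := by
      have : Tendsto (fun h : ℝ => h * K) (𝓝 0) (𝓝 (0 * K)) := tendsto_id.mul_const K
      rw [zero_mul] at this
      exact this.mono_left nhdsWithin_le_nhds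
    exact (eventually_mem_nhdsWithin (a := (0 : ℝ)) (s := Set.Ioi 0)).and
      ((h1.eventually (gt_mem_nhds (by norm_num : (0 : ℝ) < 1 / 2))).mono fun _ h => h.le)
  have hcontr : ∀ h : ℝ, 0 < h ∧ h * K ≤ 1 / 2 → ContractingWith (1 / 2) (T h) := by
    rintro h ⟨h0, hh⟩
    refine ⟨NNReal.half_lt_self one_ne_zero,
      LipschitzWith.of_dist_le_mul fun W W' => ?_⟩
    rw [dist_eq_norm, dist_eq_norm, hT]
    simp only [add_sub_add_left_eq_sub, ← smul_sub]
    rw [norm_smul, Real.norm_of_nonneg h0.le]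
    calc h * ‖Φ W - Φ W'‖ ≤ h * (K * ‖W - W'‖) := by gcongr; exact hΦlip W W'
      _ = h * K * ‖W - W'‖ := by ring
      _ ≤ _ := by
        refine mul_le_mul_of_nonneg_right (hh.trans (by norm_num)) (norm_nonneg _)
  have hfix : ∀ h : ℝ, ∃ Z, 0 < h ∧ h * K ≤ 1 / 2 → Function.IsFixedPt (T h) Z := by
    intro h
    by_cases hh : 0 < h ∧ h * K ≤ 1 / 2
    · exact ⟨_, fun _ => (hcontr h hh).fixedPoint_isFixedPt⟩
    · exact ⟨0, fun h' => absurd h' hh⟩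
  choose Z hZ using hfix
  have hdist : ∀ Y : ℝ → Fin s → E,
      (fun h => Y h - Z h) =O[𝓝[>] (0 : ℝ)] fun h => Y h - T h (Y h) := by
    intro Y
    -- The distance to the fixed point is at most the defect divided by 1 - 1/2.
    refine IsBigO.of_bound 2 ?_
    filter_upwards [hsmall] with h hh
    have := (hcontr h hh).dist_le_of_fixedPoint (Y h) (hZ h hh)
    rw [dist_eq_norm, dist_eq_norm] at this
    refine this.trans (le_of_eq ?_)
    push_cast
    ring
  have hZt : Tendsto Z (𝓝[>] 0) (𝓝 fun _ => y₀) := by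
    -- The constant `y₀` serves as approximate stages; its defect is h times a fixed vector.
    have h1 := hdist fun _ _ => y₀
    have h2 : Tendsto (fun h : ℝ => (fun _ => y₀) - T h fun _ => y₀) (𝓝[>] 0) (𝓝 0) := by
      have : Tendsto (fun h : ℝ => -(h • Φ fun _ => y₀)) (𝓝 0)
          (𝓝 (-((0 : ℝ) • Φ fun _ => y₀))) := (tendsto_id.smul_const _).neg
      rw [zero_smul, neg_zero] at this
      refine (this.mono_left nhdsWithin_le_nhds).congr fun h => ?_
      simp [hT]
    have h3 := (tendsto_const_nhds (x := fun _ : Fin s => y₀)).sub (h1.trans_tendsto h2)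
    simpa using h3
  have hTg : ∀ Y : ℝ → Fin s → E, Tendsto Y (𝓝[>] 0) (𝓝 fun _ => y₀) →
      ∀ᶠ h in 𝓝[>] (0 : ℝ), T h (Y h) = fun i => y₀ + h • ∑ j, A i j • g (Y h j) := by
    intro Y hY
    filter_upwards [hloc Y hY] with h hh
    ext1 i
    simp only [hT, hΦ, Pi.add_apply, Pi.smul_apply, hh]
  refine ⟨Z, ?_, hZt, fun Y hY => (hdist Y).congr' EventuallyEq.rfl ?_⟩
  · filter_upwards [hsmall, hTg Z hZt] with h hh hh' i
    rw [← congrFun hh' i, hZ h hh]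
  · filter_upwards [hTg Y hY] with h hh
    rw [hh]

end Stages

-- Convergence of the nonstandard stages to the current value

section NonstandardStages

variable {E : Type*} [NormedAddCommGroup E] [NormedSpace ℝ E] {N s : ℕ}

/-- The increment is h times a bounded quantity. Boundedness is asked for row `i` only, so that
explicit methods can be treated stage by stage. -/
theorem tendsto_arkStage_of_isBigO {a : ℝ → Fin N → Fin s → Fin s → ℝ} {f : Fin N → E → E} {y₀ : E}
    {Y : ℝ → Fin s → E} (hY : ∀ᶠ h in 𝓝[>] (0 : ℝ), IsARKStages (a h) f y₀ h (Y h)) (i : Fin s)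
    (hO : ∀ j ν, (fun h => a h ν i j • f ν (Y h j)) =O[𝓝[>] (0 : ℝ)] fun _ => (1 : ℝ)) :
    Tendsto (fun h => Y h i) (𝓝[>] 0) (𝓝 y₀) := by
  have h1 : (fun h : ℝ => h • ∑ j, ∑ ν, a h ν i j • f ν (Y h j)) =O[𝓝[>] (0 : ℝ)] fun h => h := by
    simpa using (isBigO_refl (fun h : ℝ => h) (𝓝[>] 0)).smul
      (IsBigO.fun_sum (s := Finset.univ) fun j _ => IsBigO.fun_sum (s := Finset.univ)
        fun ν _ => hO j ν)
  have h2 := (tendsto_const_nhds (x := y₀)).add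
    (h1.trans_tendsto (tendsto_id.mono_left nhdsWithin_le_nhds))
  rw [add_zero] at h2
  refine h2.congr' ?_
  filter_upwards [hY] with h hh using (hh i).symm

/-- In the explicit case, stage `i` involves only earlier stages, which converge by induction;
otherwise compactness bounds the values of `f`. -/
theorem tendsto_arkStages {a : ℝ → Fin N → Fin s → Fin s → ℝ} {f : Fin N → E → E} {y₀ : E}
    {Y : ℝ → Fin s → E} {D : Set E} (hY : ∀ᶠ h in 𝓝[>] (0 : ℝ), IsARKStages (a h) f y₀ h (Y h))
    (ha : ∀ ν i j, (fun h => a h ν i j) =O[𝓝[>] (0 : ℝ)] fun _ => (1 : ℝ))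
    (hf : ∀ ν, ContinuousOn (f ν) D) (hf₀ : ∀ ν, ContinuousAt (f ν) y₀)
    (hstages : (∀ᶠ h in 𝓝[>] (0 : ℝ), ∀ ν i j, i ≤ j → a h ν i j = 0) ∨
      ∃ K : Set E, IsCompact K ∧ K ⊆ D ∧ ∀ᶠ h in 𝓝[>] (0 : ℝ), ∀ i, Y h i ∈ K) :
    Tendsto Y (𝓝[>] 0) (𝓝 fun _ => y₀) := by
  refine tendsto_pi_nhds.2 fun i => ?_
  rcases hstages with hexp | ⟨K, hK, hKD, hYK⟩
  · induction i using WellFoundedLT.induction with | _ i ih =>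
    refine tendsto_arkStage_of_isBigO hY i fun j ν => ?_
    rcases lt_or_ge j i with hj | hj
    · simpa using (ha ν i j).smul (((hf₀ ν).tendsto.comp (ih j hj)).isBigO_one ℝ)
    · refine (isBigO_zero _ _).congr' ?_ EventuallyEq.rfl
      filter_upwards [hexp] with h hh
      rw [hh ν i j hj, zero_smul]
  · refine tendsto_arkStage_of_isBigO hY i fun j ν => ?_
    obtain ⟨C, hC⟩ := hK.exists_bound_of_continuousOn ((hf ν).mono hKD)
    have : (fun h => f ν (Y h j)) =O[𝓝[>] (0 : ℝ)] fun _ => (1 : ℝ) :=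
      IsBigO.of_bound C (by filter_upwards [hYK] with h hh; simpa using hC _ (hh j))
    simpa using (ha ν i j).smul this

end NonstandardStages

theorem NBseries_eq_one {N : ℕ} {E : Type*} [NormedAddCommGroup E] [NormedSpace ℝ E]
    (f : Fin N → E → E) (p : ℕ) (u : NTree N → ℝ) (y : E) (h θ : ℝ) :
    NBseries f p u y h θ = NBseries f p u y (θ * h) 1 := by
  simp only [NBseries, one_mul]

end

-- Comparison with the underlying method and the exact solution

theorem mainTheorem2 {N s d : ℕ} (M : Tableau s) (p q : ℕ) (hp : 1 ≤ p) (hq : q = max (p - 1) 1)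
    (hM : M.HasOrder p)
    (bbar : Fin s → ℝ → ℝ) (Θ : Set ℝ) (hΘ : Θ ⊆ Set.Icc 0 1)
    (hbdd : ∀ j, ∃ C : ℝ, ∀ θ ∈ Θ, |bbar j θ| ≤ C)
    (hdense : M.HasDenseOrderOn bbar Θ q)
    (D : Set (EuclideanSpace ℝ (Fin d))) (hD : IsOpen D)
    (f : Fin N → EuclideanSpace ℝ (Fin d) → EuclideanSpace ℝ (Fin d))
    (hf : ∀ ν, ContDiffOn ℝ ((q + 1 : ℕ) : WithTop ℕ∞) (f ν) D)
    (a : Fin N → Fin s → Fin s → EuclideanSpace ℝ (Fin d) → ℝ → ℝ)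
    (b : Fin N → Fin s → EuclideanSpace ℝ (Fin d) → ℝ → ℝ → ℝ)
    (yn : EuclideanSpace ℝ (Fin d)) (hyn : yn ∈ D)
    (ha : ∀ ν i j, (fun h : ℝ => a ν i j yn h - M.A i j) =O[𝓝[>] (0 : ℝ)] fun h => h ^ (q - 1))
    (hb : ∀ ν j, (fun x : ℝ × ℝ => b ν j yn x.1 x.2 - bbar j x.2)
      =O[𝓝[>] (0 : ℝ) ×ˢ 𝓟 Θ] fun x => x.1 ^ q)
    (Y : ℝ → Fin s → EuclideanSpace ℝ (Fin d))
    (hY : ∀ᶠ h in 𝓝[>] (0 : ℝ), IsARKStages (fun ν i j => a ν i j yn h) f yn h (Y h))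
    (hstages : (∀ᶠ h in 𝓝[>] (0 : ℝ), ∀ ν i j, i ≤ j → a ν i j yn h = 0) ∨
      ∃ K : Set (EuclideanSpace ℝ (Fin d)), IsCompact K ∧ K ⊆ D ∧
        ∀ᶠ h in 𝓝[>] (0 : ℝ), ∀ i, Y h i ∈ K) :
    (fun x : ℝ × ℝ => arkOutput (fun ν j => b ν j yn x.1 x.2) f yn x.1 (Y x.1)
        - NBseries f q (fun τ => 1 / (τ.density : ℝ)) yn x.1 x.2)
      =O[𝓝[>] (0 : ℝ) ×ˢ 𝓟 Θ] fun x => x.1 ^ (q + 1) := by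

  have hq1 : 1 ≤ q := hq ▸ le_max_right _ _
  have hDn : D ∈ 𝓝 yn := hD.mem_nhds hyn
  have hfq : ∀ ν, ContDiffAt ℝ q (f ν) yn := fun ν =>
    ((hf ν).contDiffAt hDn).of_le (by exact_mod_cast q.le_succ)
  have hfc : ∀ ν, ContinuousAt (f ν) yn := fun ν => (hfq ν).continuousAt
  set g : EuclideanSpace ℝ (Fin d) → EuclideanSpace ℝ (Fin d) := fun x => ∑ ν, f ν x with hg
  have hg1 : ContDiffAt ℝ 1 g yn :=
    ContDiffAt.sum fun ν _ => (hfq ν).of_le (by exact_mod_cast hq1)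
  -- the stages tend to the current value
  have ha1 : ∀ ν i j, (fun h => a ν i j yn h) =O[𝓝[>] (0 : ℝ)] fun _ => (1 : ℝ) := by
    intro ν i j
    have h1 : (fun h : ℝ => h ^ (q - 1)) =O[𝓝[>] (0 : ℝ)] fun _ => (1 : ℝ) :=
      ((continuous_pow (q - 1)).tendsto (0 : ℝ)).mono_left nhdsWithin_le_nhds |>.isBigO_one ℝ
    have h2 := ((ha ν i j).trans h1).add (isBigO_const_const (M.A i j) one_ne_zero (𝓝[>] (0 : ℝ)))
    simpa using h2
  have hYt : Tendsto Y (𝓝[>] 0) (𝓝 fun _ => yn) :=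
    tendsto_arkStages (a := fun h ν i j => a ν i j yn h) hY ha1 (fun ν => (hf ν).continuousOn) hfc
      hstages
  have hfO : ∀ ν j, (fun h => f ν (Y h j)) =O[𝓝[>] (0 : ℝ)] fun _ => (1 : ℝ) := fun ν j =>
    ((hfc ν).tendsto.comp (tendsto_pi_nhds.1 hYt j)).isBigO_one ℝ
  -- comparison with the stages of the underlying method
  obtain ⟨Z, hZ, hZt, hYZ⟩ := exists_isRKStages M.A hg1
  have hdef : (fun h => Y h - fun i => yn + h • ∑ j, M.A i j • g (Y h j))
      =O[𝓝[>] (0 : ℝ)] fun h => h ^ q := by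
    refine isBigO_pi.2 fun i => ?_
    have h1 : (fun h : ℝ => h • ∑ j, ∑ ν, (a ν i j yn h - M.A i j) • f ν (Y h j))
        =O[𝓝[>] (0 : ℝ)] fun h => h ^ q := by
      have := (isBigO_refl (fun h : ℝ => h) (𝓝[>] 0)).smul
        (IsBigO.fun_sum (s := Finset.univ) fun j _ => IsBigO.fun_sum (s := Finset.univ)
          fun ν _ => (ha ν i j).smul (hfO ν j))
      refine this.congr_right fun h => ?_
      -- The factor h in front of the stage sum recovers the order missing in the coefficients; q ≥
      -- 1 is needed for h · h^(q-1) = h^q.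
      rw [smul_eq_mul, smul_eq_mul, mul_one, mul_pow_sub_one (by omega)]
    refine h1.congr' ?_ EventuallyEq.rfl
    filter_upwards [hY] with h hh
    rw [Pi.sub_apply, hh i, add_sub_add_left_eq_sub, ← smul_sub, ← Finset.sum_sub_distrib]
    simp only [hg, Finset.smul_sum, sub_smul, Finset.sum_sub_distrib]
  have hYZq : ∀ j, (fun h => g (Y h j) - g (Z h j)) =O[𝓝[>] (0 : ℝ)] fun h => h ^ q := fun j =>
    ((hg1.hasStrictFDerivAt (by simp)).isBigO_sub.comp_tendsto
      ((tendsto_pi_nhds.1 hYt j).prodMk_nhds (tendsto_pi_nhds.1 hZt j))).trans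
      (isBigO_pi.1 ((hYZ Y hYt).trans hdef) j)
  -- comparison of the outputs
  have hout : (fun x : ℝ × ℝ => arkOutput (fun ν j => b ν j yn x.1 x.2) f yn x.1 (Y x.1)
      - rkOutput (fun j => bbar j x.2) g yn x.1 (Z x.1))
      =O[𝓝[>] (0 : ℝ) ×ˢ 𝓟 Θ] fun x => x.1 ^ (q + 1) := by
    have hbO : ∀ j, (fun x : ℝ × ℝ => bbar j x.2) =O[𝓝[>] (0 : ℝ) ×ˢ 𝓟 Θ] fun _ => (1 : ℝ) := by
      intro j
      obtain ⟨C, hC⟩ := hbdd j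
      refine IsBigO.of_bound C ?_
      filter_upwards [tendsto_snd.eventually (mem_principal_self Θ)] with x hx
      simpa using hC _ hx
    -- The difference is split into the weight error at the actual stages and the stage error under
    -- the unperturbed weights, which are bounded on `Θ`.
    have h1 : (fun x : ℝ × ℝ => x.1 • ∑ j, ((∑ ν, (b ν j yn x.1 x.2 - bbar j x.2) • f ν (Y x.1 j))
        + bbar j x.2 • (g (Y x.1 j) - g (Z x.1 j))))
        =O[𝓝[>] (0 : ℝ) ×ˢ 𝓟 Θ] fun x => x.1 ^ (q + 1) := by
      have := (isBigO_refl (fun x : ℝ × ℝ => x.1) (𝓝[>] (0 : ℝ) ×ˢ 𝓟 Θ)).smul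
        (IsBigO.fun_sum (s := Finset.univ) (g := fun x : ℝ × ℝ => x.1 ^ q) fun j _ =>
          (IsBigO.fun_sum (s := Finset.univ) (g := fun x : ℝ × ℝ => x.1 ^ q) fun ν _ => by
            simpa using (hb ν j).smul ((hfO ν j).comp_tendsto tendsto_fst)).add
          (by simpa using (hbO j).smul ((hYZq j).comp_tendsto tendsto_fst)))
      refine this.congr_right fun x => ?_
      rw [smul_eq_mul, pow_succ']
    refine h1.congr_left fun x => ?_
    rw [arkOutput, rkOutput, add_sub_add_left_eq_sub, ← smul_sub, ← Finset.sum_sub_distrib]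
    congr 1
    refine Finset.sum_congr rfl fun j _ => ?_
    simp only [sub_smul, Finset.sum_sub_distrib, ← Finset.smul_sum, smul_sub, hg]
    abel
  -- the exact solution
  obtain ⟨y, hy0, ε, hε, hy⟩ :=
    hg1.exists_forall_mem_closedBall_exists_eq_forall_mem_Ioo_hasDerivAt₀ 0
  have hysol : IsLocalSolution g yn y :=
    ⟨hy0, Filter.mem_of_superset (Ioo_mem_nhds (by linarith) (by linarith)) hy⟩
  have hrk := hdense d D g yn y Z hD (ContDiffOn.sum fun ν _ => hf ν) hyn hysol hZ
    (tendsto_pi_nhds.1 hZt)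
  have hθO : (fun x : ℝ × ℝ => x.2 * x.1) =O[𝓝[>] (0 : ℝ) ×ˢ 𝓟 Θ] fun x => x.1 := by
    refine IsBigO.of_bound 1 ?_
    filter_upwards [tendsto_snd.eventually (mem_principal_self Θ)] with x hx
    rw [norm_mul, Real.norm_of_nonneg (hΘ hx).1]
    exact mul_le_mul_of_nonneg_right (hΘ hx).2 (norm_nonneg _)
  have hθt : Tendsto (fun x : ℝ × ℝ => x.2 * x.1) (𝓝[>] (0 : ℝ) ×ˢ 𝓟 Θ) (𝓝 0) :=
    hθO.trans_tendsto (tendsto_fst.mono_right nhdsWithin_le_nhds)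
  -- The series depends on θ and h only through θh, and |θh| ≤ h makes the estimate uniform in θ.
  have hNB := ((hysol.sub_NBseries_isBigO hq1 hfq).comp_tendsto hθt).trans (hθO.pow (q + 1))
  refine ((hout.add hrk).add hNB).congr_left fun x => ?_
  rw [NBseries_eq_one f q _ yn x.1 x.2, Function.comp_apply]
  abel
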